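/- Let $V$ be a finite-dimensional real vector space. An open cone in $V$ is a non-empty open convex subset that is invariant under multiplication by positive scalars and does not contain the origin (it may contain lines). For an open cone $T$ and $x,y\in T$ put $$F_T(x,y):=\log\inf\{\lambda>0 \mid \lambda y-x\in \overline{T}\}.$$ For a cone $T$ and $x\in\partial T$ let $\tau(T,x):=\{\lambda(y-x)\mid \lambda>0,\ y\in T\}$ be the open tangent cone to $T$ at $x$; for a set $\mathbb{T}$ of cones let $\Gamma(\mathbb{T}):=\{\tau(T,x)\mid T\in\mathbb{T},\ x\in\partial T\}$, and let $\mathscr{T}(T):=\bigcup_{k\ge 1}\Gamma^k(\{T\})$. Let $C$ be an open cone in $V$ and let $b\in C$ be a basepoint. Every $T\in\mathscr{T}(C)$ is an open cone containing $C$; for $p\in T$ write $f_{T,p}(x):=F_T(x,p)-F_T(b,p)$ for $x\in T$. An almost-geodesic in $C$ is a sequence $(x_l)_{l\ge 0}$ in $C$ such that, for some $\epsilon>0$, $F_C(x_0,x_1)+\dots+F_C(x_{l-1},x_l)\le F_C(x_0,x_l)+\epsilon$ for all $l\ge1$. A Busemann point of the Funk geometry on $C$ is a function $f:C\to\mathbb{R}$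 that is the pointwise limit of $F_C(\cdot,x_l)-F_C(b,x_l)$ along some almost-geodesic $(x_l)$ and that is not of the form $F_C(\cdot,p)-F_C(b,p)$ with $p\in C$. Let $\mathcal{K}_C:=\{f_{C,p}\mid p\in C\}$ and let $\mathcal{B}_C$ be the set of all $f\in\overline{\mathcal{K}_C}\setminus\mathcal{K}_C$ (closure in the topology of pointwise convergence) that are Busemann points of the Funk geometry on $C$. Then $$\mathcal{K}_C\cup\mathcal{B}_C=\{f_{T,p}|_C \mid T\in\mathscr{T}(C),\ p\in T\},$$ and the set of Busemann points of the Funk geometry on $C$ is precisely $$\mathcal{B}_C=\{f_{T,p}|_C \mid T\in\mathscr{T}(C)\setminus\{C\},\ p\in T\}.$$ -/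

import Mathlib

open Filter Topology

noncomputable section

/-- The path `x` is an almost-geodesic for `d`: for some `ε > 0`,
`d (x 0) (x 1) + ⋯ + d (x (l-1)) (x l) ≤ d (x 0) (x l) + ε` for all `l ≥ 1`. -/
def IsAlmostGeodesic {X : Type*} (d : X → X → ℝ) (x : ℕ → X) : Prop :=
  ∃ ε : ℝ, 0 < ε ∧ ∀ l : ℕ, 1 ≤ l →
    ∑ i ∈ Finset.range l, d (x i) (x (i + 1)) ≤ d (x 0) (x l) + ε

/-- The function `d(·, p) - d(b, p)`. -/
def normalizedDist {X : Type*} (d : X → X → ℝ) (b p : X) : X → ℝ :=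
  fun y => d y p - d b p

/-- A Busemann point of `(X, d)` with basepoint `b`: a pointwise limit of `d(·, xₗ) - d(b, xₗ)`
along an almost-geodesic that is not of the form `d(·, p) - d(b, p)`.
(The topology on `X → ℝ` is that of pointwise convergence.) -/
def IsBusemannPoint {X : Type*} (d : X → X → ℝ) (b : X) (f : X → ℝ) : Prop :=
  (∃ x : ℕ → X, IsAlmostGeodesic d x ∧
    Tendsto (fun l => normalizedDist d b (x l)) atTop (𝓝 f)) ∧
  ¬ ∃ p : X, f = normalizedDist d b p

section Cone

variable {V : Type*} [NormedAddCommGroup V] [NormedSpace ℝ V]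

/-- Open cones: non-empty, open, convex, invariant under multiplication by positive scalars,
and not containing the origin.  (They may contain lines.) -/
structure IsOpenCone (C : Set V) : Prop where
  nonempty : C.Nonempty
  isOpen : IsOpen C
  convex : Convex ℝ C
  smul_mem : ∀ r : ℝ, 0 < r → ∀ x ∈ C, r • x ∈ C
  zero_notMem : (0 : V) ∉ C

/-- The relation `x ≤_C y`. -/
def coneLE (C : Set V) (x y : V) : Prop := y - x ∈ closure C

/-- The Funk metric `log inf {r > 0 ∣ x ≤_C r y}`. For an open cone `C` and `x, y ∈ C`
the infimum is that of a non-empty set and is positive. -/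
def funk (C : Set V) (x y : V) : ℝ :=
  Real.log (sInf {r : ℝ | 0 < r ∧ coneLE C x (r • y)})

/-- The open tangent cone `τ(T, x) = {r (y - x) ∣ r > 0, y ∈ T}`. -/
def openTangentCone (T : Set V) (x : V) : Set V :=
  {v | ∃ r : ℝ, 0 < r ∧ ∃ y ∈ T, v = r • (y - x)}

/-- All open tangent cones, at boundary points, of the members of a set of cones. -/
def tangentConesOf (𝕋 : Set (Set V)) : Set (Set V) :=
  {R | ∃ T ∈ 𝕋, ∃ x ∈ frontier T, R = openTangentCone T x}

/-- The iterated open tangent cones of `T`: the union over `k ≥ 1` of the `k`-fold iterates of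
`tangentConesOf` applied to `{T}`. -/
def iteratedTangentCones (T : Set V) : Set (Set V) :=
  ⋃ k ∈ Set.Ici (1 : ℕ), tangentConesOf^[k] {T}

/-- The function `f_{T,p}(x) = F_T(x, p) - F_T(b, p)`; it is only used at points `x`, `b`, `p`
of the open cone `T`. -/
def funkFun (b : V) (T : Set V) (p : V) : V → ℝ :=
  fun x => funk T x p - funk T b p

/-- The Funk metric as a function on `C × C`. -/
def funkDist (C : Set V) : C → C → ℝ := fun x y => funk C x y

/-- The set `K_C = {f_{C,p} ∣ p ∈ C}` of functions on `C`. -/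
def funkPoints (C : Set V) (b : C) : Set (C → ℝ) :=
  {f | ∃ p ∈ C, f = C.domRestrict (funkFun (b : V) C p)}

/-- The set `B_C` of those `f` in `closure K_C \ K_C` (closure for pointwise convergence)
that are Busemann points of the Funk geometry on `C`. -/
def funkBusemann (C : Set V) (b : C) : Set (C → ℝ) :=
  {f | f ∈ closure (funkPoints C b) \ funkPoints C b ∧ IsBusemannPoint (funkDist C) b f}

end Cone

end

/-! Everything is read off the dual cone T* = `nonnegFunctionals T`. The exponential of the Funk
metric is the maximum of φ x / φ y over nonzero φ ∈ T*, and passing to the tangent cone at v cuts T*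
down to its face {φ ∈ T* | φ v = 0}. Iterated tangent cones thus correspond to iterated exposed
faces of C*.

Rescaling a point p does not change f_{C,p}. Multiplying the terms of an almost-geodesic by the
exponentials of the partial sums makes it increasing for the order of C, and the bound ε with
compactness of a base of C* yields a nonzero functional bounded along it. The bounded functionals
are the dual of some iterated tangent cone T (`exists_iteratedTangentCone_eq_boundedFunctionals`),
they converge to the values at some p ∈ T, and a Dini-type argument (`IsOpenCone.tendsto_funkRatio`)
identifies the Busemann point with f_{T,p}.

Conversely, T is directed downwards for the order of C. Subtracting from p a suitable decreasing
sequence of T gives an increasing sequence of C whose bounded functionals are exactly T*. It is an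
almost-geodesic with limit f_{T,p}. If that limit were f_{C,q}, all of C* would be bounded along it,
forcing T = C. -/

section FunkGeometry

variable {V : Type*} [NormedAddCommGroup V] [NormedSpace ℝ V]

/-! ### Open cones and their duals -/

/-- The continuous linear functionals that are nonnegative on `T`. -/
def nonnegFunctionals (T : Set V) : Set (V →L[ℝ] ℝ) :=
  {φ | ∀ x ∈ T, 0 ≤ φ x}

theorem nonneg_of_mem_closure {T : Set V} {φ : V →L[ℝ] ℝ} (hφ : φ ∈ nonnegFunctionals T) {x : V}
    (hx : x ∈ closure T) : 0 ≤ φ x := by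
  have h : closure T ⊆ {y | 0 ≤ φ y} :=
    closure_minimal hφ (isClosed_le continuous_const φ.continuous)
  exact h hx

theorem eventually_add_smul_mem {T : Set V} (hT : IsOpen T) {x : V} (hx : x ∈ T) (w : V) :
    ∀ᶠ t : ℝ in 𝓝[>] 0, x + t • w ∈ T := by
  have hc : ContinuousAt (fun t : ℝ => x + t • w) 0 := by fun_prop
  have : ∀ᶠ t : ℝ in 𝓝 0, x + t • w ∈ T :=
    hc.eventually (hT.mem_nhds (by simpa using hx))
  exact this.filter_mono nhdsWithin_le_nhds

theorem IsOpenCone.pos_of_mem {T : Set V} (hT : IsOpenCone T) {φ : V →L[ℝ] ℝ}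
    (hφ : φ ∈ nonnegFunctionals T) (h0 : φ ≠ 0) {x : V} (hx : x ∈ T) : 0 < φ x := by
  rcases (hφ x hx).lt_or_eq with h | h
  · exact h
  exfalso
  obtain ⟨w, hw⟩ : ∃ w, φ w < 0 := by
    by_contra! hcon
    refine h0 (ContinuousLinearMap.ext fun w => ?_)
    have h1 := hcon w
    have h2 := hcon (-w)
    rw [map_neg] at h2
    simpa using le_antisymm (by linarith) h1
  obtain ⟨t, htT, ht⟩ :=
    ((eventually_add_smul_mem hT.isOpen hx w).and self_mem_nhdsWithin).exists
  have h1 := hφ _ htT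
  rw [map_add, map_smul, ← h, smul_eq_mul] at h1
  have : t * φ w < 0 := mul_neg_of_pos_of_neg ht hw
  linarith

/-- Hahn–Banach separation; scaling a point of T by large and by small factors fixes the signs. -/
theorem IsOpenCone.exists_nonpos_of_notMem {T : Set V} (hT : IsOpenCone T) {x : V} (hx : x ∉ T) :
    ∃ φ ∈ nonnegFunctionals T, φ ≠ 0 ∧ φ x ≤ 0 := by
  obtain ⟨f, hf⟩ := geometric_hahn_banach_open_point hT.convex hT.isOpen hx
  have key : ∀ a ∈ T, ∀ t : ℝ, 0 < t → t * f a < f x := fun a ha t ht => by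
    simpa using hf _ (hT.smul_mem t ht a ha)
  obtain ⟨a, ha⟩ := hT.nonempty
  refine ⟨-f, fun y hy => ?_, fun h => ?_, ?_⟩
  · by_contra hneg
    have hpos : 0 < f y := by simpa using hneg
    have h1 := key y hy ((|f x| + 1) / f y) (by positivity)
    rw [div_mul_cancel₀ _ hpos.ne'] at h1
    linarith [le_abs_self (f x)]
  · have : f = 0 := by simpa using h
    have h1 := hf a ha
    simp [this] at h1
  · have hlim : Tendsto (fun t : ℝ => t * f a) (𝓝[>] 0) (𝓝 0) := by
      have : Tendsto (fun t : ℝ => t * f a) (𝓝 0) (𝓝 (0 * f a)) :=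
        (continuous_id.mul continuous_const).tendsto 0
      rw [zero_mul] at this
      exact this.mono_left nhdsWithin_le_nhds
    have : 0 ≤ f x := le_of_tendsto hlim
      (by filter_upwards [self_mem_nhdsWithin] with t ht using (key a ha t ht).le)
    simpa using this

theorem IsOpenCone.mem_iff {T : Set V} (hT : IsOpenCone T) {x : V} :
    x ∈ T ↔ ∀ φ ∈ nonnegFunctionals T, φ ≠ 0 → 0 < φ x := by
  refine ⟨fun hx φ hφ h0 => hT.pos_of_mem hφ h0 hx, fun h => ?_⟩
  by_contra hx
  obtain ⟨φ, hφ, h0, hle⟩ := hT.exists_nonpos_of_notMem hx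
  exact absurd (h φ hφ h0) hle.not_gt

theorem IsOpenCone.mem_closure_iff {T : Set V} (hT : IsOpenCone T) {x : V} :
    x ∈ closure T ↔ ∀ φ ∈ nonnegFunctionals T, 0 ≤ φ x := by
  refine ⟨fun hx φ hφ => nonneg_of_mem_closure hφ hx, fun h => ?_⟩
  obtain ⟨a, ha⟩ := hT.nonempty
  have hlim : Tendsto (fun t : ℝ => x + t • a) (𝓝[>] 0) (𝓝 x) := by
    have : Tendsto (fun t : ℝ => x + t • a) (𝓝 0) (𝓝 (x + (0 : ℝ) • a)) :=
      Continuous.tendsto (by fun_prop) 0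
    rw [zero_smul, add_zero] at this
    exact this.mono_left nhdsWithin_le_nhds
  refine mem_closure_of_tendsto hlim ?_
  filter_upwards [self_mem_nhdsWithin] with t ht
  refine hT.mem_iff.2 fun φ hφ h0 => ?_
  have h1 := mul_pos (show (0 : ℝ) < t from ht) (hT.pos_of_mem hφ h0 ha)
  have h2 := h φ hφ
  rw [map_add, map_smul, smul_eq_mul]
  linarith

theorem IsOpenCone.eq_of_nonnegFunctionals_eq {T T' : Set V} (hT : IsOpenCone T)
    (hT' : IsOpenCone T') (h : nonnegFunctionals T = nonnegFunctionals T') : T = T' := by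
  ext x
  rw [hT.mem_iff, hT'.mem_iff, h]

theorem IsOpenCone.subset_of_nonnegFunctionals_subset {T T' : Set V} (hT : IsOpenCone T)
    (hT' : IsOpenCone T') (h : nonnegFunctionals T' ⊆ nonnegFunctionals T) : T ⊆ T' :=
  fun _ hx => hT'.mem_iff.2 fun _ hφ h0 => hT.pos_of_mem (h hφ) h0 hx

theorem IsOpenCone.coneLE_iff {T : Set V} (hT : IsOpenCone T) {x y : V} :
    coneLE T x y ↔ ∀ φ ∈ nonnegFunctionals T, φ x ≤ φ y := by
  simp [coneLE, hT.mem_closure_iff]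

theorem IsOpenCone.exists_ne_zero {T : Set V} (hT : IsOpenCone T) :
    ∃ φ ∈ nonnegFunctionals T, φ ≠ 0 := by
  obtain ⟨φ, hφ, h0, -⟩ := hT.exists_nonpos_of_notMem hT.zero_notMem
  exact ⟨φ, hφ, h0⟩

theorem IsOpenCone.zero_mem_frontier {T : Set V} (hT : IsOpenCone T) : (0 : V) ∈ frontier T := by
  rw [hT.isOpen.frontier_eq]
  exact ⟨hT.mem_closure_iff.2 fun φ _ => by simp, hT.zero_notMem⟩

/-! ### The Funk metric as a maximum over the dual cone -/

/-- The exponential of the Funk metric. -/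
noncomputable def funkRatio (T : Set V) (x y : V) : ℝ :=
  sInf {r : ℝ | 0 < r ∧ coneLE T x (r • y)}

theorem funk_eq_log (T : Set V) (x y : V) : funk T x y = Real.log (funkRatio T x y) := rfl

theorem bddBelow_funk_set (T : Set V) (x y : V) :
    BddBelow {r : ℝ | 0 < r ∧ coneLE T x (r • y)} :=
  ⟨0, fun _ hr => hr.1.le⟩

theorem IsOpenCone.funkRatio_le {T : Set V} (hT : IsOpenCone T) {x y : V} {r : ℝ} (hr : 0 < r)
    (h : ∀ φ ∈ nonnegFunctionals T, φ x ≤ r * φ y) : funkRatio T x y ≤ r :=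
  csInf_le (bddBelow_funk_set T x y)
    ⟨hr, hT.coneLE_iff.2 fun φ hφ => by simpa using h φ hφ⟩

theorem IsOpenCone.funk_set_nonempty {T : Set V} (hT : IsOpenCone T) (x : V) {y : V} (hy : y ∈ T) :
    {r : ℝ | 0 < r ∧ coneLE T x (r • y)}.Nonempty := by
  obtain ⟨t, htT, ht⟩ :=
    ((eventually_add_smul_mem hT.isOpen hy (-x)).and self_mem_nhdsWithin).exists
  have ht : 0 < t := ht
  refine ⟨t⁻¹, inv_pos.2 ht, subset_closure ?_⟩
  have := hT.smul_mem t⁻¹ (inv_pos.2 ht) _ htT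
  rw [smul_add, smul_smul, inv_mul_cancel₀ ht.ne', one_smul] at this
  rwa [sub_eq_add_neg]

theorem IsOpenCone.le_funkRatio_mul {T : Set V} (hT : IsOpenCone T) (x : V) {y : V} (hy : y ∈ T)
    {φ : V →L[ℝ] ℝ} (hφ : φ ∈ nonnegFunctionals T) : φ x ≤ funkRatio T x y * φ y := by
  by_cases h0 : φ = 0
  · simp [h0]
  have hpos := hT.pos_of_mem hφ h0 hy
  rw [← div_le_iff₀ hpos]
  refine le_csInf (hT.funk_set_nonempty x hy) fun r hr => ?_
  rw [div_le_iff₀ hpos]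
  simpa using hT.coneLE_iff.1 hr.2 φ hφ

theorem IsOpenCone.funkRatio_pos {T : Set V} (hT : IsOpenCone T) {x y : V} (hx : x ∈ T)
    (hy : y ∈ T) : 0 < funkRatio T x y := by
  obtain ⟨φ, hφ, h0⟩ := hT.exists_ne_zero
  have h := (hT.pos_of_mem hφ h0 hx).trans_le (hT.le_funkRatio_mul x hy hφ)
  exact pos_of_mul_pos_left h (hφ y hy)

/-- With r the infimum, r • y - x cannot lie in T, since openness would allow a smaller r. A
functional separating it from T attains the maximum. -/
theorem IsOpenCone.exists_eq_funkRatio_mul {T : Set V} (hT : IsOpenCone T) {x y : V} (hx : x ∈ T)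
    (hy : y ∈ T) : ∃ φ ∈ nonnegFunctionals T, φ ≠ 0 ∧ φ x = funkRatio T x y * φ y := by
  have hM := hT.funkRatio_pos hx hy
  have hnot : funkRatio T x y • y - x ∉ T := fun hmem => by
    have h1 : ∀ᶠ t : ℝ in 𝓝[>] 0, t < funkRatio T x y :=
      (eventually_lt_nhds hM).filter_mono nhdsWithin_le_nhds
    obtain ⟨t, ⟨htT, ht⟩, htM⟩ :=
      (((eventually_add_smul_mem hT.isOpen hmem (-y)).and self_mem_nhdsWithin).and h1).exists
    have ht : 0 < t := ht
    have h2 : funkRatio T x y ≤ funkRatio T x y - t := by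
      refine csInf_le (bddBelow_funk_set T x y) ⟨by linarith, subset_closure ?_⟩
      convert htT using 1
      module
    linarith
  obtain ⟨φ, hφ, h0, hle⟩ := hT.exists_nonpos_of_notMem hnot
  refine ⟨φ, hφ, h0, le_antisymm (hT.le_funkRatio_mul x hy hφ) ?_⟩
  rw [map_sub, map_smul, smul_eq_mul] at hle
  linarith

theorem IsOpenCone.le_funkRatio {T : Set V} (hT : IsOpenCone T) {x y : V} (hy : y ∈ T) {c : ℝ}
    {φ : V →L[ℝ] ℝ} (hφ : φ ∈ nonnegFunctionals T) (h0 : φ ≠ 0) (h : c * φ y ≤ φ x) :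
    c ≤ funkRatio T x y :=
  le_of_mul_le_mul_right (h.trans (hT.le_funkRatio_mul x hy hφ)) (hT.pos_of_mem hφ h0 hy)

theorem IsOpenCone.funkRatio_smul_right {T : Set V} (hT : IsOpenCone T) {x y : V} (hx : x ∈ T)
    (hy : y ∈ T) {c : ℝ} (hc : 0 < c) : funkRatio T x (c • y) = funkRatio T x y / c := by
  have hcy := hT.smul_mem c hc y hy
  refine le_antisymm (hT.funkRatio_le (div_pos (hT.funkRatio_pos hx hy) hc) fun φ hφ => ?_) ?_
  · have := hT.le_funkRatio_mul x hy hφ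
    rw [map_smul, smul_eq_mul]
    field_simp
    linarith
  · obtain ⟨φ, hφ, h0, h⟩ := hT.exists_eq_funkRatio_mul hx hy
    refine hT.le_funkRatio hcy hφ h0 (le_of_eq ?_)
    rw [map_smul, smul_eq_mul, h]
    field_simp

theorem IsOpenCone.funkFun_smul {T : Set V} (hT : IsOpenCone T) {b x p : V} (hb : b ∈ T)
    (hx : x ∈ T) (hp : p ∈ T) {c : ℝ} (hc : 0 < c) :
    funkFun b T (c • p) x = funkFun b T p x := by
  have h1 := hT.funkRatio_pos hx hp
  have h2 := hT.funkRatio_pos hb hp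
  simp only [funkFun, funk_eq_log]
  rw [hT.funkRatio_smul_right hx hp hc, hT.funkRatio_smul_right hb hp hc,
    Real.log_div h1.ne' hc.ne', Real.log_div h2.ne' hc.ne']
  ring

/-! ### Open tangent cones -/

theorem IsOpenCone.openTangentCone {T : Set V} (hT : IsOpenCone T) {v : V} (hv : v ∈ frontier T) :
    IsOpenCone (openTangentCone T v) := by
  rw [hT.isOpen.frontier_eq] at hv
  refine ⟨?_, ?_, ?_, ?_, ?_⟩
  · obtain ⟨a, ha⟩ := hT.nonempty
    exact ⟨_, 1, one_pos, a, ha, rfl⟩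
  · have h : _root_.openTangentCone T v =
        ⋃ r ∈ Set.Ioi (0 : ℝ), (fun w => r⁻¹ • w + v) ⁻¹' T := by
      ext w
      simp only [_root_.openTangentCone, Set.mem_ofPred_eq, Set.mem_iUnion, Set.mem_preimage,
        Set.mem_Ioi, exists_prop]
      refine exists_congr fun r => and_congr_right fun hr => ⟨?_, fun h => ⟨_, h, ?_⟩⟩
      · rintro ⟨y, hy, rfl⟩
        rwa [smul_smul, inv_mul_cancel₀ hr.ne', one_smul, sub_add_cancel]
      · rw [add_sub_cancel_right, smul_smul, mul_inv_cancel₀ hr.ne', one_smul]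
    rw [h]
    exact isOpen_biUnion fun r _ => hT.isOpen.preimage (by fun_prop)
  · rintro _ ⟨r, hr, y, hy, rfl⟩ _ ⟨s, hs, z, hz, rfl⟩ a c ha hc hac
    have hpos : 0 < a * r + c * s := by
      rcases ha.lt_or_eq with h | h
      · have := mul_pos h hr
        have := mul_nonneg hc hs.le
        linarith
      · have hc1 : c = 1 := by linarith
        rw [← h, hc1]
        linarith
    refine ⟨a * r + c * s, hpos, (a * r / (a * r + c * s)) • y + (c * s / (a * r + c * s)) • z,
      hT.convex hy hz (by positivity) (by positivity) (by field_simp), ?_⟩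
    rw [smul_sub (a * r + c * s), smul_add (a * r + c * s), smul_smul (a * r + c * s),
      smul_smul (a * r + c * s), mul_div_cancel₀ _ hpos.ne', mul_div_cancel₀ _ hpos.ne']
    module
  · rintro t ht _ ⟨r, hr, y, hy, rfl⟩
    exact ⟨t * r, mul_pos ht hr, y, hy, smul_smul _ _ _⟩
  · rintro ⟨r, hr, y, hy, h⟩
    have h1 := smul_eq_zero.1 h.symm
    rcases h1 with h1 | h1
    · exact hr.ne' h1
    · exact hv.2 (sub_eq_zero.1 h1 ▸ hy)

/-- Nonnegativity on the tangent cone means φ v ≤ t * φ y for all y ∈ T and t > 0: large t gives φ ∈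
T*, small t gives φ v ≤ 0. -/
theorem IsOpenCone.mem_nonnegFunctionals_openTangentCone_iff {T : Set V} (hT : IsOpenCone T)
    {v : V} (hv : v ∈ frontier T) {φ : V →L[ℝ] ℝ} :
    φ ∈ nonnegFunctionals (_root_.openTangentCone T v) ↔ φ ∈ nonnegFunctionals T ∧ φ v = 0 := by
  constructor
  · intro h
    have key : ∀ y ∈ T, φ v ≤ φ y := fun y hy => by
      simpa using h _ ⟨1, one_pos, y, hy, rfl⟩
    have key2 : ∀ y ∈ T, ∀ t : ℝ, 0 < t → φ v ≤ t * φ y := fun y hy t ht => by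
      simpa using key _ (hT.smul_mem t ht y hy)
    have hφ : φ ∈ nonnegFunctionals T := fun y hy => by
      by_contra! hneg
      have h1 := key2 y hy ((|φ v| + 1) / (-φ y)) (div_pos (by positivity) (by linarith))
      have h2 : (|φ v| + 1) / (-φ y) * φ y = -(|φ v| + 1) := by
        have : φ y ≠ 0 := hneg.ne
        field_simp
      linarith [neg_abs_le (φ v)]
    refine ⟨hφ, le_antisymm ?_ (nonneg_of_mem_closure hφ (frontier_subset_closure hv))⟩
    obtain ⟨y, hy⟩ := hT.nonempty
    by_contra! hpos
    have h1 := key2 y hy (φ v / (2 * (φ y + 1)))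
      (div_pos hpos (by linarith [hφ y hy]))
    have hy0 := hφ y hy
    have h2 : φ v / (2 * (φ y + 1)) * φ y < φ v := by
      rw [div_mul_eq_mul_div, div_lt_iff₀ (by linarith)]
      nlinarith
    linarith
  · rintro ⟨hφ, h0⟩ _ ⟨r, hr, y, hy, rfl⟩
    rw [map_smul, map_sub, h0, sub_zero]
    exact mul_nonneg hr.le (hφ y hy)

theorem openTangentCone_zero {T : Set V} (hT : IsOpenCone T) : openTangentCone T 0 = T := by
  refine (hT.openTangentCone hT.zero_mem_frontier).eq_of_nonnegFunctionals_eq hT ?_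
  ext φ
  simp [hT.mem_nonnegFunctionals_openTangentCone_iff hT.zero_mem_frontier]

/-! ### Iterated tangent cones -/

theorem openTangentCone_mem_iteratedTangentCones {C T : Set V} (hT : T ∈ iteratedTangentCones C)
    {v : V} (hv : v ∈ frontier T) : openTangentCone T v ∈ iteratedTangentCones C := by
  simp only [iteratedTangentCones, Set.mem_iUnion, Set.mem_Ici, exists_prop] at hT ⊢
  obtain ⟨k, -, hk⟩ := hT
  refine ⟨k + 1, by omega, ?_⟩
  rw [Function.iterate_succ_apply']
  exact ⟨T, hk, v, hv, rfl⟩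

theorem self_mem_iteratedTangentCones {C : Set V} (hC : IsOpenCone C) :
    C ∈ iteratedTangentCones C := by
  simp only [iteratedTangentCones, Set.mem_iUnion, Set.mem_Ici, exists_prop]
  exact ⟨1, le_rfl, C, rfl, 0, hC.zero_mem_frontier, (openTangentCone_zero hC).symm⟩

theorem iteratedTangentCones_induction {C : Set V} (P : Set V → Prop) (hself : P C)
    (hstep : ∀ T, P T → ∀ v ∈ frontier T, P (openTangentCone T v)) {T : Set V}
    (hT : T ∈ iteratedTangentCones C) : P T := by
  simp only [iteratedTangentCones, Set.mem_iUnion, Set.mem_Ici, exists_prop] at hT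
  obtain ⟨k, -, hk⟩ := hT
  induction k generalizing T with
  -- The condition k ≥ 1 was dropped, so the induction can start from C itself.
  | zero => rwa [show T = C from hk]
  | succ k ih =>
    rw [Function.iterate_succ_apply'] at hk
    obtain ⟨S, hS, v, hv, rfl⟩ := hk
    exact hstep S (ih hS) v hv

theorem isOpenCone_of_mem_iteratedTangentCones {C : Set V} (hC : IsOpenCone C) {T : Set V}
    (hT : T ∈ iteratedTangentCones C) :
    IsOpenCone T ∧ nonnegFunctionals T ⊆ nonnegFunctionals C := by
  refine iteratedTangentCones_induction
    (fun T => IsOpenCone T ∧ nonnegFunctionals T ⊆ nonnegFunctionals C) ⟨hC, subset_rfl⟩ ?_ hT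
  rintro T ⟨hT, hsub⟩ v hv
  exact ⟨hT.openTangentCone hv, fun φ hφ =>
    hsub ((hT.mem_nonnegFunctionals_openTangentCone_iff hv).1 hφ).1⟩

/-- An iterated tangent cone of `C` is directed downwards for the strict order of `C`. -/
theorem exists_sub_mem_of_mem_iteratedTangentCones {C : Set V} (hC : IsOpenCone C) {T : Set V}
    (hT : T ∈ iteratedTangentCones C) :
    ∀ a ∈ T, ∀ c ∈ T, ∃ d ∈ T, a - d ∈ C ∧ c - d ∈ C := by
  refine (iteratedTangentCones_induction
    (fun T => IsOpenCone T ∧ ∀ a ∈ T, ∀ c ∈ T, ∃ d ∈ T, a - d ∈ C ∧ c - d ∈ C)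
    ⟨hC, fun a ha c hc => ?_⟩ ?_ hT).2
  · obtain ⟨t, ⟨h1, h2⟩, ht⟩ := (((eventually_add_smul_mem hC.isOpen ha (-a)).and
      (eventually_add_smul_mem hC.isOpen hc (-a))).and self_mem_nhdsWithin).exists
    refine ⟨t • a, hC.smul_mem t ht a ha, ?_, ?_⟩
    · simpa [sub_eq_add_neg] using h1
    · simpa [sub_eq_add_neg] using h2
  · rintro T ⟨hT, hdir⟩ v hv
    have hτ := hT.openTangentCone hv
    refine ⟨hτ, ?_⟩
    -- A large multiple of v moves both points into T; the lower bound found there is moved back,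
    -- and stays in the tangent cone because its functionals vanish at v.
    have hadd : ∀ a ∈ openTangentCone T v, ∃ n : ℝ, ∀ m ≥ n, a + m • v ∈ T := by
      rintro _ ⟨r, hr, y, hy, rfl⟩
      refine ⟨r, fun m hm => hT.mem_iff.2 fun φ hφ h0 => ?_⟩
      have h1 := mul_pos hr (hT.pos_of_mem hφ h0 hy)
      have h2 := mul_nonneg (sub_nonneg.2 hm)
        (nonneg_of_mem_closure hφ (frontier_subset_closure hv))
      simp only [map_add, map_smul, map_sub, smul_eq_mul]
      nlinarith
    intro a ha c hc
    obtain ⟨n, hn⟩ := hadd a ha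
    obtain ⟨m, hm⟩ := hadd c hc
    obtain ⟨d, hd, h1, h2⟩ :=
      hdir _ (hn (max n m) (le_max_left _ _)) _ (hm (max n m) (le_max_right _ _))
    refine ⟨d - max n m • v, hτ.mem_iff.2 fun φ hφ h0 => ?_, ?_, ?_⟩
    · obtain ⟨hφT, hφv⟩ := (hT.mem_nonnegFunctionals_openTangentCone_iff hv).1 hφ
      simpa [hφv] using hT.pos_of_mem hφT h0 hd
    · rwa [← sub_add, sub_add_eq_add_sub]
    · rwa [← sub_add, sub_add_eq_add_sub]

/-! ### Limits of functionals along sequences -/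

/-- The functionals, nonnegative on `C`, that are bounded above along the sequence `y`. -/
def boundedFunctionals (C : Set V) (y : ℕ → V) : Set (V →L[ℝ] ℝ) :=
  {φ | φ ∈ nonnegFunctionals C ∧ BddAbove (Set.range fun l => φ (y l))}

/-- If the functionals in `S` are bounded along a sequence, then along a subsequence they converge
to the values at some vector. -/
theorem exists_subseq_tendsto_of_bounded [FiniteDimensional ℝ V] (S : Set (V →L[ℝ] ℝ))
    (z : ℕ → V) (h : ∀ φ ∈ S, ∃ B : ℝ, ∀ l, |φ (z l)| ≤ B) :
    ∃ v : V, ∃ s : ℕ → ℕ, StrictMono s ∧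
      ∀ φ ∈ S, Tendsto (fun l => φ (z (s l))) atTop (𝓝 (φ v)) := by
  -- A basis of the span taken from S gives finitely many bounded coordinates; the closed range of
  -- the coordinate map supplies v.
  obtain ⟨f, hfS, hspan, -⟩ := Submodule.exists_fun_fin_finrank_span_eq ℝ S
  choose B hB using fun i => h (f i) (hfS i)
  let A := ContinuousLinearMap.pi f
  have hmem : ∀ l, A (z l) ∈ Set.Icc (-B) B := fun l =>
    ⟨fun i => (abs_le.1 (hB i l)).1, fun i => (abs_le.1 (hB i l)).2⟩
  obtain ⟨a, -, s, hs, hlim⟩ := isCompact_Icc.tendsto_subseq hmem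
  have hcl := Submodule.closed_of_finiteDimensional (LinearMap.range A.toLinearMap)
  obtain ⟨v, rfl⟩ : a ∈ LinearMap.range A.toLinearMap :=
    hcl.mem_of_tendsto hlim (Eventually.of_forall fun l => ⟨z (s l), rfl⟩)
  refine ⟨v, s, hs, fun φ hφ => ?_⟩
  have hφ' : φ ∈ Submodule.span ℝ (Set.range f) := by
      rw [hspan]
      exact Submodule.subset_span hφ
  obtain ⟨c, rfl⟩ := (Submodule.mem_span_range_iff_exists_fun ℝ).1 hφ'
  have hi : ∀ i, Tendsto (fun l => f i (z (s l))) atTop (𝓝 (f i v)) := fun i =>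
    (tendsto_pi_nhds.1 hlim) i
  simpa using tendsto_finsetSum Finset.univ fun i _ => (hi i).const_mul (c i)

/-- If the functionals in `S` converge along a sequence, then the limits are the values at some
vector. -/
theorem exists_tendsto_of_tendsto [FiniteDimensional ℝ V] (S : Set (V →L[ℝ] ℝ))
    (z : ℕ → V) (h : ∀ φ ∈ S, ∃ L : ℝ, Tendsto (fun l => φ (z l)) atTop (𝓝 L)) :
    ∃ v : V, ∀ φ ∈ S, Tendsto (fun l => φ (z l)) atTop (𝓝 (φ v)) := by
  obtain ⟨v, s, hs, hv⟩ := exists_subseq_tendsto_of_bounded S z fun φ hφ => by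
    obtain ⟨L, hL⟩ := h φ hφ
    obtain ⟨B, hB⟩ := (Metric.isBounded_range_of_tendsto _ hL).exists_norm_le
    exact ⟨B, fun l => hB _ ⟨l, rfl⟩⟩
  refine ⟨v, fun φ hφ => ?_⟩
  obtain ⟨L, hL⟩ := h φ hφ
  rwa [tendsto_nhds_unique (hv φ hφ) (hL.comp hs.tendsto_atTop)]

theorem isClosed_nonnegFunctionals (C : Set V) : IsClosed (nonnegFunctionals C) := by
  have : nonnegFunctionals C = ⋂ x ∈ C, {φ : V →L[ℝ] ℝ | 0 ≤ φ x} := by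
    ext φ
    simp [nonnegFunctionals]
  rw [this]
  exact isClosed_biInter fun x _ => isClosed_le continuous_const (by fun_prop)

theorem IsOpenCone.isCompact_nonnegFunctionals [FiniteDimensional ℝ V] {C : Set V}
    (hC : IsOpenCone C) {b : V} (hb : b ∈ C) :
    IsCompact {φ : V →L[ℝ] ℝ | φ ∈ nonnegFunctionals C ∧ φ b = 1} := by
  have hcl : IsClosed {φ : V →L[ℝ] ℝ | φ ∈ nonnegFunctionals C ∧ φ b = 1} :=
    (isClosed_nonnegFunctionals C).inter
      (isClosed_eq (f := fun φ : V →L[ℝ] ℝ => φ b) (by fun_prop) continuous_const)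
  obtain ⟨r, hr, hball⟩ := Metric.isOpen_iff.1 hC.isOpen b hb
  refine Metric.isCompact_of_isClosed_isBounded hcl
    (isBounded_iff_forall_norm_le.2 ⟨2 / r, ?_⟩)
  rintro φ ⟨hφ, hφb⟩
  -- Both b + w and b - w lie in C, and φ b = 1.
  have key : ∀ w : V, ‖w‖ < r → |φ w| ≤ 1 := fun w hw => by
    have h1 := hφ (b + w) (hball (by simpa using hw))
    have h2 := hφ (b - w) (hball (by simpa [dist_eq_norm] using hw))
    rw [map_add, hφb] at h1
    rw [map_sub, hφb] at h2
    exact abs_le.2 ⟨by linarith, by linarith⟩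
  refine ContinuousLinearMap.opNorm_le_bound _ (by positivity) fun w => ?_
  by_cases hw : w = 0
  · simp [hw]
  have hw' : 0 < ‖w‖ := norm_pos_iff.2 hw
  have h1 := key ((r / (2 * ‖w‖)) • w) (by
    rw [norm_smul, Real.norm_of_nonneg (by positivity)]
    field_simp
    linarith)
  rw [map_smul, smul_eq_mul, abs_mul, abs_of_pos (by positivity)] at h1
  rw [Real.norm_eq_abs]
  field_simp at h1 ⊢
  linarith

/-- Compactness of the base of the dual cone, along a sequence that increases for `C`. -/
theorem IsOpenCone.exists_forall_mul_le_of_frequently [FiniteDimensional ℝ V] {C : Set V}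
    (hC : IsOpenCone C) {y : ℕ → V}
    (hmono : ∀ φ ∈ nonnegFunctionals C, Monotone fun l => φ (y l)) {x : V} {c : ℝ} (hc : 0 ≤ c)
    (h : ∃ᶠ l in atTop, ∃ φ ∈ nonnegFunctionals C, φ ≠ 0 ∧ c * φ (y l) ≤ φ x) :
    ∃ φ ∈ nonnegFunctionals C, φ ≠ 0 ∧ ∀ k, c * φ (y k) ≤ φ x := by
  obtain ⟨b, hb⟩ := hC.nonempty
  -- These sets are compact, and nested because y increases; Cantor's intersection theorem gives φ.
  let t : ℕ → Set (V →L[ℝ] ℝ) := fun k =>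
    {φ | φ ∈ nonnegFunctionals C ∧ φ b = 1} ∩ {φ | c * φ (y k) ≤ φ x}
  have hclosed : ∀ k, IsClosed {φ : V →L[ℝ] ℝ | c * φ (y k) ≤ φ x} := fun k =>
    isClosed_le (by fun_prop) (by fun_prop)
  have hcomp := hC.isCompact_nonnegFunctionals hb
  obtain ⟨φ, hφ⟩ := IsCompact.nonempty_iInter_of_sequence_nonempty_isCompact_isClosed t
    (fun k φ hφ => ⟨hφ.1, le_trans (mul_le_mul_of_nonneg_left
      (hmono φ hφ.1.1 (Nat.le_succ k)) hc) hφ.2⟩)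
    (fun k => by
      obtain ⟨l, hkl, φ, hφ, h0, hle⟩ := (Filter.frequently_atTop.1 h) k
      have hpos := hC.pos_of_mem hφ h0 hb
      refine ⟨(φ b)⁻¹ • φ, ⟨fun w hw => ?_, ?_⟩, ?_⟩
      · exact mul_nonneg (inv_nonneg.2 hpos.le) (hφ w hw)
      · exact inv_mul_cancel₀ hpos.ne'
      · have h1 := (mul_le_mul_of_nonneg_left (hmono φ hφ hkl) hc).trans hle
        have h2 := mul_le_mul_of_nonneg_left h1 (inv_nonneg.2 hpos.le)
        change c * ((φ b)⁻¹ * φ (y k)) ≤ (φ b)⁻¹ * φ x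
        linarith)
    (hcomp.inter_right (hclosed 0)) (fun k => hcomp.isClosed.inter (hclosed k))
  rw [Set.mem_iInter] at hφ
  refine ⟨φ, (hφ 0).1.1, fun h0 => ?_, fun k => (hφ k).2⟩
  have := (hφ 0).1.2
  simp [h0] at this

/-- Continuity of the Funk metric along an increasing sequence, with limit given by the cone dual
to the functionals that stay bounded. -/
theorem IsOpenCone.tendsto_funkRatio [FiniteDimensional ℝ V] {C T : Set V}
    (hC : IsOpenCone C) (hT : IsOpenCone T) {y : ℕ → V} (hy : ∀ l, y l ∈ C)
    (hmono : ∀ φ ∈ nonnegFunctionals C, Monotone fun l => φ (y l))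
    (hD : nonnegFunctionals T = boundedFunctionals C y) {p : V} (hp : p ∈ T)
    (hlim : ∀ φ ∈ nonnegFunctionals T, Tendsto (fun l => φ (y l)) atTop (𝓝 (φ p)))
    {x : V} (hx : x ∈ C) :
    Tendsto (fun l => funkRatio C x (y l)) atTop (𝓝 (funkRatio T x p)) := by
  have hDC : nonnegFunctionals T ⊆ nonnegFunctionals C := fun φ hφ => by
    rw [hD] at hφ
    exact hφ.1
  have hxT : x ∈ T := hC.subset_of_nonnegFunctionals_subset hT hDC hx
  have hMpos := hT.funkRatio_pos hxT hp
  refine tendsto_order.2 ⟨fun a ha => ?_, fun a ha => ?_⟩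
  · obtain ⟨φ, hφ, h0, he⟩ := hT.exists_eq_funkRatio_mul hxT hp
    have hφp := hT.pos_of_mem hφ h0 hp
    have h1 : Tendsto (fun l => φ x / φ (y l)) atTop (𝓝 (φ x / φ p)) :=
      tendsto_const_nhds.div (hlim φ hφ) hφp.ne'
    have h2 : a < φ x / φ p := by rwa [he, mul_div_cancel_right₀ _ hφp.ne']
    filter_upwards [h1.eventually (lt_mem_nhds h2)] with l hl
    have hφy := hC.pos_of_mem (hDC hφ) h0 (hy l)
    exact hl.trans_le
      (hC.le_funkRatio (hy l) (hDC hφ) h0 (by rw [div_mul_cancel₀ _ hφy.ne']))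
  -- If the ratio is frequently at least a, compactness gives one φ with a * φ (y k) ≤ φ x for all
  -- k. So φ is bounded along y, hence lies in T*, and in the limit contradicts the choice of a.
  · by_contra hcon
    have hfreq : ∃ᶠ l in atTop, ∃ φ ∈ nonnegFunctionals C, φ ≠ 0 ∧ a * φ (y l) ≤ φ x := by
      rw [Filter.not_eventually] at hcon
      refine hcon.mono fun l hl => ?_
      obtain ⟨φ, hφ, h0, he⟩ := hC.exists_eq_funkRatio_mul hx (hy l)
      exact ⟨φ, hφ, h0, he ▸ mul_le_mul_of_nonneg_right (not_lt.1 hl) (hφ _ (hy l))⟩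
    have ha0 : 0 < a := hMpos.trans ha
    obtain ⟨φ, hφ, h0, hle⟩ := hC.exists_forall_mul_le_of_frequently hmono ha0.le hfreq
    have hφT : φ ∈ nonnegFunctionals T := by
      rw [hD]
      refine ⟨hφ, φ x / a, ?_⟩
      rintro _ ⟨k, rfl⟩
      rw [le_div_iff₀ ha0, mul_comm]
      exact hle k
    have h1 : a * φ p ≤ φ x :=
      le_of_tendsto ((hlim φ hφT).const_mul a) (Eventually.of_forall hle)
    exact ha.not_ge (hT.le_funkRatio hp hφT h0 h1)

theorem IsOpenCone.tendsto_funk [FiniteDimensional ℝ V] {C T : Set V}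
    (hC : IsOpenCone C) (hT : IsOpenCone T) {y : ℕ → V} (hy : ∀ l, y l ∈ C)
    (hmono : ∀ φ ∈ nonnegFunctionals C, Monotone fun l => φ (y l))
    (hD : nonnegFunctionals T = boundedFunctionals C y) {p : V} (hp : p ∈ T)
    (hlim : ∀ φ ∈ nonnegFunctionals T, Tendsto (fun l => φ (y l)) atTop (𝓝 (φ p)))
    {x : V} (hx : x ∈ C) :
    Tendsto (fun l => funk C x (y l)) atTop (𝓝 (funk T x p)) := by
  have hDC : nonnegFunctionals T ⊆ nonnegFunctionals C := fun φ hφ => by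
    rw [hD] at hφ
    exact hφ.1
  exact (hC.tendsto_funkRatio hT hy hmono hD hp hlim hx).log
    (hT.funkRatio_pos (hC.subset_of_nonnegFunctionals_subset hT hDC hx) hp).ne'

/-! ### Iterated tangent cones and increasing sequences -/

/-- The functionals that stay bounded along a sequence increasing for `C` are dual to an iterated
tangent cone of `C`. -/
theorem exists_iteratedTangentCone_eq_boundedFunctionals [FiniteDimensional ℝ V] {C : Set V}
    (hC : IsOpenCone C) {y : ℕ → V} (hy : ∀ l, y l ∈ C)
    (hmono : ∀ φ ∈ nonnegFunctionals C, Monotone fun l => φ (y l))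
    (hne : ∃ φ ∈ boundedFunctionals C y, φ ≠ 0) :
    ∃ T ∈ iteratedTangentCones C, nonnegFunctionals T = boundedFunctionals C y := by
  -- Induction on the dimension of the span of T*: while T* contains an unbounded functional, a
  -- tangent cone lowers it.
  suffices H : ∀ n : ℕ, ∀ T ∈ iteratedTangentCones C,
      Module.finrank ℝ (Submodule.span ℝ (nonnegFunctionals T)) = n →
      boundedFunctionals C y ⊆ nonnegFunctionals T →
      ∃ T ∈ iteratedTangentCones C, nonnegFunctionals T = boundedFunctionals C y from
    H _ C (self_mem_iteratedTangentCones hC) rfl fun φ hφ => hφ.1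
  intro n
  induction n using Nat.strong_induction_on with
  | _ n ih =>
  intro T hTC hn hsub
  obtain ⟨hT, hDC⟩ := isOpenCone_of_mem_iteratedTangentCones hC hTC
  have hCT := hC.subset_of_nonnegFunctionals_subset hT hDC
  by_cases hall : nonnegFunctionals T ⊆ boundedFunctionals C y
  · exact ⟨T, hTC, hall.antisymm hsub⟩
  obtain ⟨φ₀, hφ₀, hφ₀'⟩ := Set.not_subset.1 hall
  obtain ⟨f, hf, hspan, -⟩ := Submodule.exists_fun_fin_finrank_span_eq ℝ (nonnegFunctionals T)
  -- The sum of a basis taken from T* dominates every element of T* up to a constant, so it tends to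
  -- infinity along y.
  obtain ⟨ψ, hψ_apply⟩ : ∃ ψ : V →L[ℝ] ℝ, ∀ w, ψ w = ∑ i, f i w := ⟨∑ i, f i, fun w => by simp⟩
  have hψ : ψ ∈ nonnegFunctionals T := fun w hw => by
    rw [hψ_apply]
    exact Finset.sum_nonneg fun i _ => hf i w hw
  have hdom : ∀ φ ∈ nonnegFunctionals T, ∃ K : ℝ, 0 ≤ K ∧ ∀ w ∈ T, φ w ≤ K * ψ w := by
    intro φ hφ
    have hφ' : φ ∈ Submodule.span ℝ (Set.range f) := by
      rw [hspan]
      exact Submodule.subset_span hφ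
    obtain ⟨c, rfl⟩ := (Submodule.mem_span_range_iff_exists_fun ℝ).1 hφ'
    refine ⟨∑ i, |c i|, Finset.sum_nonneg fun i _ => abs_nonneg _, fun w hw => ?_⟩
    rw [Finset.sum_mul]
    have : (∑ i, c i • f i) w = ∑ i, c i * f i w := by simp
    rw [this]
    refine Finset.sum_le_sum fun i _ => ?_
    have h1 : f i w ≤ ψ w := by
      rw [hψ_apply]
      exact Finset.single_le_sum (f := fun j => f j w) (fun j _ => hf j w hw) (Finset.mem_univ i)
    exact (mul_le_mul_of_nonneg_right (le_abs_self _) (hf i w hw)).trans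
      (mul_le_mul_of_nonneg_left h1 (abs_nonneg _))
  have hψunb : ¬ BddAbove (Set.range fun l => ψ (y l)) := by
    rintro ⟨B, hB⟩
    obtain ⟨K, hK, hKle⟩ := hdom φ₀ hφ₀
    refine hφ₀' ⟨hDC hφ₀, K * B, ?_⟩
    rintro _ ⟨l, rfl⟩
    exact (hKle _ (hCT (hy l))).trans (mul_le_mul_of_nonneg_left (hB ⟨l, rfl⟩) hK)
  have hψ0 : ψ ≠ 0 := fun h => hψunb ⟨0, by rintro _ ⟨l, rfl⟩; simp [h]⟩
  have hψpos : ∀ l, 0 < ψ (y l) := fun l => hT.pos_of_mem hψ hψ0 (hCT (hy l))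
  have hψtop : Tendsto (fun l => ψ (y l)) atTop atTop :=
    (tendsto_atTop_of_monotone (hmono ψ (hDC hψ))).resolve_right fun ⟨L, hL⟩ =>
      hψunb hL.bddAbove_range
  -- The direction v in which y escapes: bounded functionals vanish there, while ψ v = 1.
  obtain ⟨v, s, hs, hv⟩ := exists_subseq_tendsto_of_bounded (nonnegFunctionals T)
    (fun l => (ψ (y l))⁻¹ • y l) fun φ hφ => by
      obtain ⟨K, -, hK⟩ := hdom φ hφ
      refine ⟨K, fun l => ?_⟩
      rw [map_smul, smul_eq_mul, abs_of_nonneg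
        (mul_nonneg (inv_nonneg.2 (hψpos l).le) (hφ _ (hCT (hy l)))), inv_mul_le_iff₀ (hψpos l),
        mul_comm]
      exact hK _ (hCT (hy l))
  simp only [map_smul, smul_eq_mul] at hv
  have hvE : ∀ φ ∈ boundedFunctionals C y, φ v = 0 := by
    intro φ hφ
    obtain ⟨B, hB⟩ := hφ.2
    refine tendsto_nhds_unique (hv φ (hsub hφ)) ?_
    have hz : Tendsto (fun l => (ψ (y (s l)))⁻¹) atTop (𝓝 0) :=
      (tendsto_inv_atTop_zero.comp hψtop).comp hs.tendsto_atTop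
    have hzB := hz.mul_const B
    rw [zero_mul] at hzB
    exact squeeze_zero
      (fun l => mul_nonneg (inv_nonneg.2 (hψpos _).le) (hφ.1 _ (hy _)))
      (fun l => mul_le_mul_of_nonneg_left (hB ⟨s l, rfl⟩) (inv_nonneg.2 (hψpos _).le)) hzB
  have hψv : ψ v = 1 := by
    refine tendsto_nhds_unique (hv ψ hψ) ?_
    simp only [inv_mul_cancel₀ (hψpos _).ne']
    exact tendsto_const_nhds
  have hvcl : v ∈ closure T := hT.mem_closure_iff.2 fun φ hφ =>
    ge_of_tendsto (hv φ hφ) (Eventually.of_forall fun l =>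
      mul_nonneg (inv_nonneg.2 (hψpos _).le) (hφ _ (hCT (hy _))))
  have hvfr : v ∈ frontier T := by
    rw [hT.isOpen.frontier_eq]
    refine ⟨hvcl, fun hvT => ?_⟩
    obtain ⟨φ, hφ, h0⟩ := hne
    exact (hT.pos_of_mem (hsub hφ) h0 hvT).ne' (hvE φ hφ)
  refine ih _ ?_ (openTangentCone T v) (openTangentCone_mem_iteratedTangentCones hTC hvfr) rfl
    fun φ hφ => (hT.mem_nonnegFunctionals_openTangentCone_iff hvfr).2 ⟨hsub hφ, hvE φ hφ⟩
  rw [← hn]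
  refine Submodule.finrank_lt_finrank_of_lt (lt_of_le_of_ne (Submodule.span_mono fun φ hφ =>
    ((hT.mem_nonnegFunctionals_openTangentCone_iff hvfr).1 hφ).1) fun heq => ?_)
  have hmem : ψ ∈ Submodule.span ℝ (nonnegFunctionals (openTangentCone T v)) :=
    heq ▸ Submodule.subset_span hψ
  have hzero : ∀ χ ∈ Submodule.span ℝ (nonnegFunctionals (openTangentCone T v)), χ v = 0 := by
    intro χ hχ
    induction hχ using Submodule.span_induction with
    | mem φ h => exact ((hT.mem_nonnegFunctionals_openTangentCone_iff hvfr).1 h).2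
    | zero => simp
    | add φ χ _ _ h1 h2 => simp [h1, h2]
    | smul a φ _ h => simp [h]
  linarith [hzero ψ hmem]

/-- A point of an iterated tangent cone is approached by an increasing sequence in `C`. -/
theorem exists_increasing_seq_of_mem_iteratedTangentCones [FiniteDimensional ℝ V] {C T : Set V}
    (hC : IsOpenCone C) (hTC : T ∈ iteratedTangentCones C) {p : V} (hp : p ∈ T) :
    ∃ y : ℕ → V, (∀ l, y l ∈ C) ∧
      (∀ φ ∈ nonnegFunctionals C, Monotone fun l => φ (y l)) ∧
      nonnegFunctionals T = boundedFunctionals C y ∧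
      ∀ φ ∈ nonnegFunctionals T, Tendsto (fun l => φ (y l)) atTop (𝓝 (φ p)) := by
  obtain ⟨hT, hDC⟩ := isOpenCone_of_mem_iteratedTangentCones hC hTC
  have hdir := exists_sub_mem_of_mem_iteratedTangentCones hC hTC
  have hdir' : ∀ a c : T, ∃ d : T, (a : V) - d ∈ C ∧ (c : V) - d ∈ C := fun a c => by
    obtain ⟨d, hd, h⟩ := hdir a a.2 c c.2
    exact ⟨⟨d, hd⟩, h⟩
  choose g hg₁ hg₂ using hdir'
  have : Nonempty T := ⟨⟨p, hp⟩⟩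
  let q := TopologicalSpace.denseSeq T
  -- A decreasing sequence in T that starts below p and eventually passes below every term of a
  -- dense sequence. So φ (c l) tends to 0 for φ ∈ T* and is unbounded below for other φ ∈ C*.
  obtain ⟨c, hc, hcs⟩ : ∃ c : ℕ → T, c 0 = g ⟨p, hp⟩ ⟨p, hp⟩ ∧ ∀ n, c (n + 1) = g (c n) (q n) :=
    ⟨fun n => Nat.rec (motive := fun _ => T) (g ⟨p, hp⟩ ⟨p, hp⟩) (fun n d => g d (q n)) n,
      rfl, fun _ => rfl⟩
  have hc0 : p - (c 0 : V) ∈ C := hc ▸ hg₁ ⟨p, hp⟩ ⟨p, hp⟩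
  have hanti : ∀ φ ∈ nonnegFunctionals C, Antitone fun l => φ (c l) := fun φ hφ =>
    antitone_nat_of_succ_le fun n => by
      have := hφ _ (hg₁ (c n) (q n))
      rw [map_sub] at this
      rw [hcs]
      linarith
  have hcq : ∀ φ ∈ nonnegFunctionals C, ∀ n, ∀ l ≥ n + 1, φ (c l) ≤ φ (q n) :=
    fun φ hφ n l hl => by
      have := hφ _ (hg₂ (c n) (q n))
      rw [map_sub, ← hcs] at this
      linarith [hanti φ hφ hl]
  have hmono : ∀ φ ∈ nonnegFunctionals C, Monotone fun l => φ (p - c l) := fun φ hφ m n hmn => by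
    have := hanti φ hφ hmn
    simp only [map_sub]
    linarith
  have hdense : ∀ (φ : V →L[ℝ] ℝ) (a : ℝ), (∃ w ∈ T, φ w < a) → ∃ n, φ (q n) < a := by
    rintro φ a ⟨w, hw, hlt⟩
    have hopen : IsOpen {w : T | φ w < a} := isOpen_lt (by fun_prop) continuous_const
    obtain ⟨n, hn⟩ :=
      (TopologicalSpace.denseRange_denseSeq T).exists_mem_open hopen ⟨⟨w, hw⟩, hlt⟩
    exact ⟨n, hn⟩
  have hlim : ∀ φ ∈ nonnegFunctionals T,
      Tendsto (fun l => φ (p - c l)) atTop (𝓝 (φ p)) := by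
    intro φ hφ
    have h0 : Tendsto (fun l => φ (c l)) atTop (𝓝 0) := by
      refine tendsto_order.2 ⟨fun a ha => Eventually.of_forall fun l =>
        ha.trans_le (hφ _ (c l).2), fun a ha => ?_⟩
      obtain ⟨n, hn⟩ := hdense φ a <| by
        have hp0 := hφ p hp
        refine ⟨(a / (2 * (φ p + 1))) • p, hT.smul_mem _ (by positivity) p hp, ?_⟩
        rw [map_smul, smul_eq_mul, div_mul_eq_mul_div, div_lt_iff₀ (by positivity)]
        nlinarith
      filter_upwards [eventually_ge_atTop (n + 1)] with l hl
      exact (hcq φ (hDC hφ) n l hl).trans_lt hn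
    simpa using (tendsto_const_nhds (x := φ p)).sub h0
  refine ⟨fun l => p - c l, fun l => hC.mem_iff.2 fun φ hφ hne => ?_, hmono, ?_, hlim⟩
  · exact (hC.pos_of_mem hφ hne hc0).trans_le (hmono φ hφ (Nat.zero_le l))
  · refine Set.Subset.antisymm (fun φ hφ => ⟨hDC hφ, (hlim φ hφ).bddAbove_range⟩) ?_
    rintro φ ⟨hφ, B, hB⟩ w hw
    by_contra! hneg
    obtain ⟨n, hn⟩ := hdense φ (φ p - B) <| by
      refine ⟨((|φ p - B| + 1) / (-φ w)) • w,
        hT.smul_mem _ (div_pos (by positivity) (by linarith)) w hw, ?_⟩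
      have : (|φ p - B| + 1) / (-φ w) * φ w = -(|φ p - B| + 1) := by
        have := hneg.ne
        field_simp
      rw [map_smul, smul_eq_mul, this]
      linarith [neg_abs_le (φ p - B)]
    have h1 := hB ⟨n + 1, rfl⟩
    simp only [map_sub] at h1
    linarith [hcq φ hφ n (n + 1) le_rfl]

/-! ### Busemann points -/

theorem isBusemannPoint_of_mem_iteratedTangentCones [FiniteDimensional ℝ V] {C T : Set V}
    (hC : IsOpenCone C) (b : C) (hTC : T ∈ iteratedTangentCones C) (hne : T ≠ C) {p : V}
    (hp : p ∈ T) : IsBusemannPoint (funkDist C) b (C.domRestrict (funkFun (b : V) T p)) := by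
  obtain ⟨hT, hDC⟩ := isOpenCone_of_mem_iteratedTangentCones hC hTC
  have hCT := hC.subset_of_nonnegFunctionals_subset hT hDC
  obtain ⟨y, hy, hmono, hD, hlim⟩ := exists_increasing_seq_of_mem_iteratedTangentCones hC hTC hp
  have hfunk : ∀ x ∈ C, Tendsto (fun l => funk C x (y l)) atTop (𝓝 (funk T x p)) :=
    fun x hx => hC.tendsto_funk hT hy hmono hD hp hlim hx
  have hle : ∀ k l, k ≤ l → funk C (y k) (y l) ≤ 0 := fun k l hkl =>
    Real.log_nonpos (hC.funkRatio_pos (hy k) (hy l)).le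
      (hC.funkRatio_le one_pos fun φ hφ => by simpa using hmono φ hφ hkl)
  refine ⟨⟨fun l => ⟨y l, hy l⟩, ?_, ?_⟩, ?_⟩
  · obtain ⟨m, hm⟩ := (hfunk _ (hy 0)).bddBelow_range
    refine ⟨|m| + 1, by positivity, fun l _ => ?_⟩
    have h1 : m ≤ funk C (y 0) (y l) := hm ⟨l, rfl⟩
    have h2 : ∑ i ∈ Finset.range l, funk C (y i) (y (i + 1)) ≤ 0 :=
      Finset.sum_nonpos fun i _ => hle _ _ (Nat.le_succ i)
    change ∑ i ∈ Finset.range l, funk C (y i) (y (i + 1)) ≤ funk C (y 0) (y l) + (|m| + 1)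
    linarith [neg_abs_le m]
  · exact tendsto_pi_nhds.2 fun x => (hfunk x x.2).sub (hfunk b b.2)
  -- Equality with f_{C,q} would bound the Funk distances from y k to q above, hence bound every φ ∈
  -- C* along y.
  · rintro ⟨q, hq⟩
    refine hne (hT.eq_of_nonnegFunctionals_eq hC (hDC.antisymm fun φ hφ => ?_))
    rw [hD]
    have hval : ∀ x ∈ C, funk T x p - funk T b p = funk C x q - funk C b q := fun x hx =>
      congrFun hq ⟨x, hx⟩
    refine ⟨hφ, Real.exp (funk C b q - funk T b p) * φ q, ?_⟩
    rintro _ ⟨k, rfl⟩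
    have h1 : funk T (y k) p ≤ 0 :=
      le_of_tendsto (hfunk _ (hy k)) (eventually_atTop.2 ⟨k, fun l hl => hle k l hl⟩)
    have h2 : funk C (y k) q ≤ funk C b q - funk T b p := by linarith [hval _ (hy k)]
    have h3 : funkRatio C (y k) q ≤ Real.exp (funk C b q - funk T b p) :=
      (Real.log_le_iff_le_exp (hC.funkRatio_pos (hy k) q.2)).1 h2
    exact (hC.le_funkRatio_mul (y k) q.2 hφ).trans
      (mul_le_mul_of_nonneg_right h3 (hφ _ q.2))

theorem IsBusemannPoint.exists_mem_iteratedTangentCones [FiniteDimensional ℝ V] {C : Set V}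
    (hC : IsOpenCone C) (b : C) {f : C → ℝ} (hf : IsBusemannPoint (funkDist C) b f) :
    ∃ T ∈ iteratedTangentCones C \ {C}, ∃ p ∈ T,
      f = C.domRestrict (funkFun (b : V) T p) := by
  obtain ⟨⟨x, ⟨ε, -, hx⟩, hxlim⟩, hnot⟩ := hf
  let S : ℕ → ℝ := fun l => ∑ i ∈ Finset.range l, funkDist C (x i) (x (i + 1))
  -- The factor absorbs the Funk distance of each step, making y increasing.
  let y : ℕ → V := fun l => Real.exp (S l) • (x l : V)
  have hy : ∀ l, y l ∈ C := fun l => hC.smul_mem _ (Real.exp_pos _) _ (x l).2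
  have hmono : ∀ φ ∈ nonnegFunctionals C, Monotone fun l => φ (y l) := fun φ hφ =>
    monotone_nat_of_le_succ fun l => by
      have h1 := hC.funkRatio_pos (x l).2 (x (l + 1)).2
      have h2 : Real.exp (S (l + 1)) = Real.exp (S l) * funkRatio C (x l) (x (l + 1)) := by
        simp only [S]
        rw [Finset.sum_range_succ, Real.exp_add, funkDist, funk_eq_log, Real.exp_log h1]
      simp only [y, map_smul, smul_eq_mul]
      rw [h2, mul_assoc]
      exact mul_le_mul_of_nonneg_left (hC.le_funkRatio_mul _ (x (l + 1)).2 hφ) (Real.exp_pos _).le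
  -- The almost-geodesic inequality says that the Funk ratio of x 0 to y l is at least exp (-ε);
  -- this yields a nonzero functional bounded along y.
  obtain ⟨χ, hχ, hχ0, hχle⟩ := hC.exists_forall_mul_le_of_frequently hmono (x := x 0)
    (Real.exp_pos (-ε)).le <| Eventually.frequently <| by
      filter_upwards [eventually_ge_atTop 1] with l hl
      have hM := hC.funkRatio_pos (x 0).2 (x l).2
      obtain ⟨φ, hφ, h0, he⟩ := hC.exists_eq_funkRatio_mul (x 0).2 (x l).2
      refine ⟨φ, hφ, h0, ?_⟩
      rw [he, map_smul, smul_eq_mul, ← mul_assoc, ← Real.exp_add]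
      refine mul_le_mul_of_nonneg_right ((Real.le_log_iff_exp_le hM).1 ?_) (hφ _ (x l).2)
      have h1 : S l ≤ funk C (x 0) (x l) + ε := hx l hl
      rw [← funk_eq_log]
      linarith
  obtain ⟨T, hTC, hD⟩ := exists_iteratedTangentCone_eq_boundedFunctionals hC hy hmono
    ⟨χ, ⟨hχ, (χ (x 0)) / Real.exp (-ε), by
      rintro _ ⟨k, rfl⟩
      rw [le_div_iff₀ (Real.exp_pos _), mul_comm]
      exact hχle k⟩, hχ0⟩
  obtain ⟨hT, hDC⟩ := isOpenCone_of_mem_iteratedTangentCones hC hTC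
  have hbdd : ∀ φ ∈ nonnegFunctionals T, BddAbove (Set.range fun l => φ (y l)) := fun φ hφ => by
    rw [hD] at hφ
    exact hφ.2
  obtain ⟨p, hlim⟩ := exists_tendsto_of_tendsto (nonnegFunctionals T) y fun φ hφ =>
    ⟨_, tendsto_atTop_ciSup (hmono φ (hDC hφ)) (hbdd φ hφ)⟩
  have hp : p ∈ T := hT.mem_iff.2 fun φ hφ h0 =>
    (hC.pos_of_mem (hDC hφ) h0 (hy 0)).trans_le
      (ge_of_tendsto (hlim φ hφ) (Eventually.of_forall fun l => hmono φ (hDC hφ) (Nat.zero_le l)))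
  have hfeq : f = C.domRestrict (funkFun (b : V) T p) := by
    refine tendsto_nhds_unique hxlim (tendsto_pi_nhds.2 fun z => ?_)
    have h1 : ∀ l, normalizedDist (funkDist C) b (x l) z = funk C z (y l) - funk C b (y l) :=
      fun l => (hC.funkFun_smul b.2 z.2 (x l).2 (Real.exp_pos (S l))).symm
    simp only [h1]
    exact (hC.tendsto_funk hT hy hmono hD hp hlim z.2).sub
      (hC.tendsto_funk hT hy hmono hD hp hlim b.2)
  refine ⟨T, ⟨hTC, ?_⟩, p, hp, hfeq⟩
  rintro rfl
  exact hnot ⟨⟨p, hp⟩, hfeq⟩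

theorem mem_funkPoints_iff {C : Set V} {b : C} {f : C → ℝ} :
    f ∈ funkPoints C b ↔ ∃ p : C, f = normalizedDist (funkDist C) b p :=
  ⟨fun ⟨p, hp, h⟩ => ⟨⟨p, hp⟩, h⟩, fun ⟨p, h⟩ => ⟨p, p.2, h⟩⟩

theorem setOf_isBusemannPoint_eq_funkBusemann (C : Set V) (b : C) :
    {f : C → ℝ | IsBusemannPoint (funkDist C) b f} = funkBusemann C b := by
  refine Set.Subset.antisymm (fun f hf => ⟨⟨?_, fun h => hf.2 (mem_funkPoints_iff.1 h)⟩, hf⟩)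
    fun f hf => hf.2
  obtain ⟨x, -, hx⟩ := hf.1
  exact mem_closure_of_tendsto hx
    (Eventually.of_forall fun l => mem_funkPoints_iff.2 ⟨x l, rfl⟩)

theorem funkBusemann_eq [FiniteDimensional ℝ V] {C : Set V} (hC : IsOpenCone C) (b : C) :
    funkBusemann C b =
      {f : C → ℝ | ∃ T ∈ iteratedTangentCones C \ {C}, ∃ p ∈ T,
        f = C.domRestrict (funkFun (b : V) T p)} := by
  rw [← setOf_isBusemannPoint_eq_funkBusemann]
  refine Set.Subset.antisymm (fun f hf => hf.exists_mem_iteratedTangentCones hC b) ?_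
  rintro _ ⟨T, ⟨hTC, hne⟩, p, hp, rfl⟩
  exact isBusemannPoint_of_mem_iteratedTangentCones hC b hTC hne hp

end FunkGeometry

theorem mainTheorem4 {V : Type*} [NormedAddCommGroup V] [NormedSpace ℝ V] [FiniteDimensional ℝ V]
    (C : Set V) (hC : IsOpenCone C) (b : C) :
    funkPoints C b ∪ funkBusemann C b =
        {f : C → ℝ | ∃ T ∈ iteratedTangentCones C, ∃ p ∈ T, f = C.domRestrict (funkFun (b : V) T p)} ∧
      {f : C → ℝ | IsBusemannPoint (funkDist C) b f} = funkBusemann C b ∧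
      funkBusemann C b =
        {f : C → ℝ | ∃ T ∈ iteratedTangentCones C \ {C}, ∃ p ∈ T,
          f = C.domRestrict (funkFun (b : V) T p)} := by
  refine ⟨?_, setOf_isBusemannPoint_eq_funkBusemann C b, funkBusemann_eq hC b⟩
  rw [funkBusemann_eq hC b]
  ext f
  constructor
  · rintro (⟨p, hp, rfl⟩ | ⟨T, hT, h⟩)
    · exact ⟨C, self_mem_iteratedTangentCones hC, p, hp, rfl⟩
    · exact ⟨T, hT.1, h⟩
  · rintro ⟨T, hT, p, hp, rfl⟩
    by_cases h : T = C
    · subst h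
      exact Or.inl ⟨p, hp, rfl⟩
    · exact Or.inr ⟨T, ⟨hT, h⟩, p, hp, rfl⟩
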